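/- Let $V=\mathbb{C}^2$. For $r,s,t\in\operatorname{End}(V\otimes V)$ put $$\llbracket r,s,t\rrbracket=(r\otimes I)(I\otimes s)(t\otimes I)-(I\otimes t)(s\otimes I)(I\otimes r)\in\operatorname{End}(V\otimes V\otimes V).$$ A six-vertex matrix is an endomorphism $u$ of $V\otimes V$ whose matrix in the basis $e_1\otimes e_1,\,e_1\otimes e_2,\,e_2\otimes e_1,\,e_2\otimes e_2$ is $$u=\begin{pmatrix}a_1&&&\\&c_1&b_1&\\&b_2&c_2&\\&&&a_2\end{pmatrix},\qquad c_1,c_2\ne 0 .$$ Put $N(u)=a_1a_2+b_1b_2-c_1c_2$, $\det B(u)=c_1c_2-b_1b_2$. A groupoid is a set $G$ with a partially defined composition $\star$ and an inverse map $x\mapsto x'$ such that: if $a\star b$ and $b\star c$ are defined, then $(a\star b)\star c$ and $a\star(b\star c)$ are defined and equal; $a\star a'$ and $a'\star a$ are always defined; and if $a\star b$ is defined then $(a\star b)\star b'=a$ and $a'\star(a\star b)=b$ (all these being defined). A groupoid parametrized Yang–Baxter equation with object map $\Delta:G\to M$ is a map $\pi:G\to\operatorname{End}(V\otimes V)$ such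 that $\llbracket\pi(g),\pi(g\star h),\pi(h)\rrbracket=0$ whenever $g\star h$ is defined, $g\star h$ is defined if and only if $\Delta(g)=\Delta(h')$, and then $\Delta(g\star h)=\Delta(h)$ and $\Delta((g\star h)')=\Delta(g')$. Let $\mathfrak{G}_{\mathrm{ff}}=\operatorname{GL}(2,\mathbb{C})\times\mathbb{C}^\times$, let $\pi\left(\begin{pmatrix}a_1&-b_2\\b_1&a_2\end{pmatrix},c_1\right)$ be the six-vertex matrix with weights $a_1,a_2,b_1,b_2,c_1$ and $c_2=(a_1a_2+b_1b_2)/c_1$, and let $\Delta=(0,0)$ on $\mathfrak{G}_{\mathrm{ff}}$. Let $\overline\Omega$ be the set of six-vertex matrices satisfying one of the following: - $a_1,a_2,b_1,b_2,N(u)\neq0$; - $a_1,a_2\ne0$ and $b_1=b_2=a_1a_2-c_1c_2=0$; - $b_1,b_2\neq0$ and $a_1=a_2=b_1b_2-c_1c_2=0$. Let $$\mathfrak{G}_{\mathrm{nf}}=\{(u,d_1,d_2)\in\overline\Omega\times\mathbb{C}^\times\times\mathbb{C}^\times\mid a_1b_1d_1=a_2b_2d_2=N(u)\},$$ with $\pi(u,d_1,d_2)=u$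 and $\Delta(u,d_1,d_2)=(d_1,d_2)$. (In the first case $d_1,d_2$ are determined by $u$; in the other two they are arbitrary, so that these two boundary components are blown up.) For $x=(u,d_1,d_2)\in\mathfrak{G}_{\mathrm{nf}}$ put $a_1^*(x)=a_2-d_1b_1$ and $a_2^*(x)=a_1-d_2b_2$; thus $a_i^*(x)=\det B(u)/a_i$ if $a_i\neq0$. **Theorem.** There is a groupoid structure on $\mathfrak{G}_{\mathrm{nf}}$ with the following properties. 1. The inverse of $x=(u,d_1,d_2)$ is $x'=(u',d_1',d_2')$, where $u'$ is $(c_1c_2)^{-1}$ times the six-vertex matrix with weights $(a_1,a_2,b_1,b_2,c_1,c_2)$ replaced by $(a_1^*(x),a_2^*(x),-b_1,-b_2,c_2,c_1)$, and $(d_1',d_2')=\left(\frac{a_1}{a_2}d_1,\frac{a_2}{a_1}d_2\right)$ if $a_1\ne0$, $(d_1',d_2')=\left(\frac{b_2}{b_1}d_2,\frac{b_1}{b_2}d_1\right)$ if $a_1=0$. 2. If $z=x\star y$ is defined, then $\Delta(z)=\Delta(y)$ and the weights of $z$ are $$\begin{aligned}a_1(z)&=a_1(x)a_1(y)-b_2(x)b_1(y),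 & a_2(z)&=a_2(x)a_2(y)-b_1(x)b_2(y),\\ b_1(z)&=a_1^*(x)b_1(y)+b_1(x)a_1(y), & b_2(z)&=a_2^*(x)b_2(y)+b_2(x)a_2(y),\\ c_1(z)&=c_1(x)c_1(y), & c_2(z)&=c_2(x)c_2(y).\end{aligned}$$ 3. Let $\mathfrak{G}=\mathfrak{G}_{\mathrm{ff}}\sqcup\mathfrak{G}_{\mathrm{nf}}$ be the disjoint union of the group $\mathfrak{G}_{\mathrm{ff}}$ and this groupoid. Then $\pi:\mathfrak{G}\to\operatorname{End}(V\otimes V)$ is a groupoid parametrized Yang–Baxter equation with object map $\Delta:\mathfrak{G}\to(\mathbb{C}^\times)^2\cup\{(0,0)\}$. 4. Let $u,v$ be six-vertex matrices in general position, meaning that all six weights of each are nonzero. There exists a six-vertex matrix $w$ with $\llbracket u,w,v\rrbracket=0$ if and only if there exist $g,h\in\mathfrak{G}$ such that $u=\pi(g)$, $v=\pi(h)$ and $g\star h$ is defined. Moreover, for any $g,h\in\mathfrak{G}$ with $\pi(g)=u$ and $\pi(h)=v$, the composition $g\star h$ is defined if and only if such a $w$ exists, and then the six-vertex solutions $w$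 are exactly the six-vertex matrices that are nonzero scalar multiples of $\pi(g\star h)$. -/

import Mathlib

open scoped TensorProduct

noncomputable section

/-- A groupoid in the sense of a set with a partially defined composition `a ⋆ b` and an inverse map:
if `a ⋆ b` and `b ⋆ c` are defined, then `(a ⋆ b) ⋆ c` and `a ⋆ (b ⋆ c)` are defined and equal;
`a ⋆ a'` and `a' ⋆ a` are always defined; and `a ⋆ b ⋆ b' = a`, `a' ⋆ a ⋆ b = b` whenever `a ⋆ b`
is defined. -/
structure PartialGroupoid (G : Type*) where
  Defined : G → G → Prop
  comp : ∀ a b : G, Defined a b → G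
  inv : G → G
  assoc : ∀ (a b c : G) (hab : Defined a b) (hbc : Defined b c),
    ∃ (h₁ : Defined (comp a b hab) c) (h₂ : Defined a (comp b c hbc)),
      comp (comp a b hab) c h₁ = comp a (comp b c hbc) h₂
  defined_inv : ∀ a : G, Defined a (inv a)
  inv_defined : ∀ a : G, Defined (inv a) a
  comp_comp_inv : ∀ (a b : G) (hab : Defined a b),
    ∃ h : Defined (comp a b hab) (inv b), comp (comp a b hab) (inv b) h = a
  inv_comp_comp : ∀ (a b : G) (hab : Defined a b),
    ∃ h : Defined (inv a) (comp a b hab), comp (inv a) (comp a b hab) h = b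

/-- A group, regarded as a groupoid in which every composition is defined. -/
def PartialGroupoid.ofGroup (G : Type*) [Group G] : PartialGroupoid G where
  Defined _ _ := True
  comp a b _ := a * b
  inv a := a⁻¹
  assoc a b c _ _ := ⟨trivial, trivial, mul_assoc a b c⟩
  defined_inv _ := trivial
  inv_defined _ := trivial
  comp_comp_inv a b _ := ⟨trivial, mul_inv_cancel_right a b⟩
  inv_comp_comp a b _ := ⟨trivial, inv_mul_cancel_left a b⟩

/-- The disjoint union of two groupoids: elements of different components are never composable. -/
def PartialGroupoid.sum {G H : Type*} (A : PartialGroupoid G) (B : PartialGroupoid H) :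
    PartialGroupoid (G ⊕ H) where
  Defined
    | .inl a, .inl b => A.Defined a b
    | .inr a, .inr b => B.Defined a b
    | .inl _, .inr _ => False
    | .inr _, .inl _ => False
  comp
    | .inl a, .inl b, h => .inl (A.comp a b h)
    | .inr a, .inr b, h => .inr (B.comp a b h)
    | .inl _, .inr _, h => h.elim
    | .inr _, .inl _, h => h.elim
  inv
    | .inl a => .inl (A.inv a)
    | .inr a => .inr (B.inv a)
  assoc := by
    rintro (a | a) (b | b) (c | c) hab hbc
    · obtain ⟨h₁, h₂, h⟩ := A.assoc a b c hab hbc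
      exact ⟨h₁, h₂, congrArg Sum.inl h⟩
    · exact hbc.elim
    · exact hab.elim
    · exact hab.elim
    · exact hab.elim
    · exact hab.elim
    · exact hbc.elim
    · obtain ⟨h₁, h₂, h⟩ := B.assoc a b c hab hbc
      exact ⟨h₁, h₂, congrArg Sum.inr h⟩
  defined_inv := by
    rintro (a | a)
    · exact A.defined_inv a
    · exact B.defined_inv a
  inv_defined := by
    rintro (a | a)
    · exact A.inv_defined a
    · exact B.inv_defined a
  comp_comp_inv := by
    rintro (a | a) (b | b) hab
    · obtain ⟨h, e⟩ := A.comp_comp_inv a b hab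
      exact ⟨h, congrArg Sum.inl e⟩
    · exact hab.elim
    · exact hab.elim
    · obtain ⟨h, e⟩ := B.comp_comp_inv a b hab
      exact ⟨h, congrArg Sum.inr e⟩
  inv_comp_comp := by
    rintro (a | a) (b | b) hab
    · obtain ⟨h, e⟩ := A.inv_comp_comp a b hab
      exact ⟨h, congrArg Sum.inl e⟩
    · exact hab.elim
    · exact hab.elim
    · obtain ⟨h, e⟩ := B.inv_comp_comp a b hab
      exact ⟨h, congrArg Sum.inr e⟩

/-- The Yang-Baxter commutator
`⟦r, s, t⟧ = (r ⊗ I)(I ⊗ s)(t ⊗ I) - (I ⊗ t)(s ⊗ I)(I ⊗ r)` on `V ⊗ V ⊗ V`. -/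
def ybCommutator {V : Type*} [AddCommGroup V] [Module ℂ V] (r s t : Module.End ℂ (V ⊗[ℂ] V)) :
    Module.End ℂ ((V ⊗[ℂ] V) ⊗[ℂ] V) :=
  let L : Module.End ℂ (V ⊗[ℂ] V) → Module.End ℂ ((V ⊗[ℂ] V) ⊗[ℂ] V) := fun f => f.rTensor V
  let R : Module.End ℂ (V ⊗[ℂ] V) → Module.End ℂ ((V ⊗[ℂ] V) ⊗[ℂ] V) := fun f =>
    (TensorProduct.assoc ℂ V V V).symm.toLinearMap ∘ₗ f.lTensor V ∘ₗ
      (TensorProduct.assoc ℂ V V V).toLinearMap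
  L r * R s * L t - R t * L s * R r

/-- `π : G → End (V ⊗ V)` is a groupoid parametrized Yang-Baxter equation with object map
`Δ : G → M`. -/
structure IsGroupoidYangBaxter {G V M : Type*} [AddCommGroup V] [Module ℂ V]
    (Γ : PartialGroupoid G) (π : G → Module.End ℂ (V ⊗[ℂ] V)) (Δ : G → M) : Prop where
  yang_baxter : ∀ (u v : G) (h : Γ.Defined u v),
    ybCommutator (π u) (π (Γ.comp u v h)) (π v) = 0
  defined_iff : ∀ u v : G, Γ.Defined u v ↔ Δ u = Δ (Γ.inv v)
  obj_comp : ∀ (u v : G) (h : Γ.Defined u v), Δ (Γ.comp u v h) = Δ v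
  obj_inv_comp : ∀ (u v : G) (h : Γ.Defined u v), Δ (Γ.inv (Γ.comp u v h)) = Δ (Γ.inv u)

/-- The Boltzmann weights of a six-vertex matrix; `c₁` and `c₂` are nonzero. -/
@[ext]
structure SixVertex where
  a₁ : ℂ
  a₂ : ℂ
  b₁ : ℂ
  b₂ : ℂ
  c₁ : ℂ
  c₂ : ℂ
  c₁_ne : c₁ ≠ 0
  c₂_ne : c₂ ≠ 0

namespace SixVertex

/-- The matrix in the ordered basis `e₁ ⊗ e₁, e₁ ⊗ e₂, e₂ ⊗ e₁, e₂ ⊗ e₂`. -/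
def toMatrix (u : SixVertex) : Matrix (Fin 4) (Fin 4) ℂ :=
  !![u.a₁, 0, 0, 0;
     0, u.c₁, u.b₁, 0;
     0, u.b₂, u.c₂, 0;
     0, 0, 0, u.a₂]

/-- The endomorphism of `ℂ² ⊗ ℂ²` given by the six-vertex matrix. The equivalence
`finProdFinEquiv : Fin 2 × Fin 2 ≃ Fin 4` is the lexicographic one. -/
def toEnd (u : SixVertex) : Module.End ℂ ((Fin 2 → ℂ) ⊗[ℂ] (Fin 2 → ℂ)) :=
  Matrix.toLin ((Pi.basisFun ℂ (Fin 2)).tensorProduct (Pi.basisFun ℂ (Fin 2)))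
    ((Pi.basisFun ℂ (Fin 2)).tensorProduct (Pi.basisFun ℂ (Fin 2)))
    (u.toMatrix.submatrix finProdFinEquiv finProdFinEquiv)

/-- The determinant of the middle block. -/
def detB (u : SixVertex) : ℂ := u.c₁ * u.c₂ - u.b₁ * u.b₂

/-- `N(u) = a₁ a₂ + b₁ b₂ - c₁ c₂`; the matrix is free-fermionic if this vanishes. -/
def N (u : SixVertex) : ℂ := u.a₁ * u.a₂ + u.b₁ * u.b₂ - u.c₁ * u.c₂

/-- General position: all six weights are nonzero. -/
def IsGeneric (u : SixVertex) : Prop := u.a₁ ≠ 0 ∧ u.a₂ ≠ 0 ∧ u.b₁ ≠ 0 ∧ u.b₂ ≠ 0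

/-- The open stratum. -/
def OmegaOpen : Set SixVertex := {u | u.IsGeneric ∧ u.detB ≠ 0 ∧ u.N ≠ 0}

/-- The boundary stratum `b₁ = b₂ = 0 = a₁ a₂ - c₁ c₂`. -/
def Omega_b : Set SixVertex :=
  {u | u.a₁ ≠ 0 ∧ u.a₂ ≠ 0 ∧ u.b₁ = 0 ∧ u.b₂ = 0 ∧ u.a₁ * u.a₂ - u.c₁ * u.c₂ = 0}

/-- The boundary stratum `a₁ = a₂ = 0 = b₁ b₂ - c₁ c₂`. -/
def Omega_a : Set SixVertex :=
  {u | u.b₁ ≠ 0 ∧ u.b₂ ≠ 0 ∧ u.a₁ = 0 ∧ u.a₂ = 0 ∧ u.b₁ * u.b₂ - u.c₁ * u.c₂ = 0}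

/-- The boundary stratum of singular non-free-fermionic matrices. -/
def Omega_B : Set SixVertex := {u | u.IsGeneric ∧ u.N ≠ 0 ∧ u.detB = 0}

def OmegaBar : Set SixVertex := OmegaOpen ∪ Omega_b ∪ Omega_a ∪ Omega_B

end SixVertex

/-- The underlying set of the non-free-fermionic groupoid: triples `(u, d₁, d₂)` with
`u ∈ OmegaBar`, `d₁, d₂ ∈ ℂˣ` and `a₁ b₁ d₁ = a₂ b₂ d₂ = N(u)`. Over `OmegaOpen` and `Omega_B` the
pair `(d₁, d₂)` is determined by `u`; over `Omega_b` and `Omega_a` it is arbitrary. -/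
@[ext]
structure NonFreeFermionic where
  u : SixVertex
  d₁ : ℂˣ
  d₂ : ℂˣ
  mem : u ∈ SixVertex.OmegaBar
  eq₁ : u.a₁ * u.b₁ * d₁ = u.N
  eq₂ : u.a₂ * u.b₂ * d₂ = u.N

namespace NonFreeFermionic

/-- The weight `a₁(x*)`, where `u*` is the continuous extension of
`u ↦ det B(u) • u⁻¹` to the whole groupoid. See `aStar₁_eq` and `aStar₁_eq_of_a₁_eq_zero`. -/
def aStar₁ (x : NonFreeFermionic) : ℂ := x.u.a₂ - x.d₁ * x.u.b₁

/-- The weight `a₂(x*)`. -/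
def aStar₂ (x : NonFreeFermionic) : ℂ := x.u.a₁ - x.d₂ * x.u.b₂

theorem aStar₁_eq (x : NonFreeFermionic) (h : x.u.a₁ ≠ 0) :
    x.aStar₁ = x.u.detB / x.u.a₁ := by
  have h₁ := x.eq₁
  rw [eq_div_iff h]
  simp only [aStar₁, SixVertex.detB, SixVertex.N] at *
  linear_combination -h₁

theorem aStar₂_eq (x : NonFreeFermionic) (h : x.u.a₂ ≠ 0) :
    x.aStar₂ = x.u.detB / x.u.a₂ := by
  have h₂ := x.eq₂
  rw [eq_div_iff h]
  simp only [aStar₂, SixVertex.detB, SixVertex.N] at *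
  linear_combination -h₂

theorem a₁_eq_zero_iff (x : NonFreeFermionic) : x.u.a₁ = 0 ↔ x.u ∈ SixVertex.Omega_a := by
  refine ⟨fun h => ?_, fun h => h.2.2.1⟩
  rcases x.mem with ((h' | h') | h') | h'
  · exact absurd h h'.1.1
  · exact absurd h h'.1
  · exact h'
  · exact absurd h h'.1.1

theorem aStar₁_eq_of_a₁_eq_zero (x : NonFreeFermionic) (h : x.u.a₁ = 0) :
    x.aStar₁ = -(x.d₁ * x.u.b₁) ∧ x.aStar₂ = -(x.d₂ * x.u.b₂) := by
  have h' := x.a₁_eq_zero_iff.1 h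
  simp [aStar₁, aStar₂, h, h'.2.2.2.1]

/-- `y` is the groupoid inverse `x' = (c₁ c₂)⁻¹ x*` of `x`. In the last two fields, `a₁ = 0` singles
out the points over `Omega_a`. -/
structure IsInverse (x y : NonFreeFermionic) : Prop where
  a₁ : y.u.a₁ = x.aStar₁ / (x.u.c₁ * x.u.c₂)
  a₂ : y.u.a₂ = x.aStar₂ / (x.u.c₁ * x.u.c₂)
  b₁ : y.u.b₁ = -x.u.b₁ / (x.u.c₁ * x.u.c₂)
  b₂ : y.u.b₂ = -x.u.b₂ / (x.u.c₁ * x.u.c₂)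
  c₁ : y.u.c₁ = x.u.c₂ / (x.u.c₁ * x.u.c₂)
  c₂ : y.u.c₂ = x.u.c₁ / (x.u.c₁ * x.u.c₂)
  d₁ : (y.d₁ : ℂ) = if x.u.a₁ = 0 then x.u.b₂ / x.u.b₁ * x.d₂ else x.u.a₁ / x.u.a₂ * x.d₁
  d₂ : (y.d₂ : ℂ) = if x.u.a₁ = 0 then x.u.b₁ / x.u.b₂ * x.d₁ else x.u.a₂ / x.u.a₁ * x.d₂

/-- `z` is the groupoid composition `x ⋆ y`: the normalized solution of the Yang-Baxter equation
with `Δ(z) = Δ(y)`. -/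
structure IsComposition (x y z : NonFreeFermionic) : Prop where
  a₁ : z.u.a₁ = x.u.a₁ * y.u.a₁ - x.u.b₂ * y.u.b₁
  a₂ : z.u.a₂ = x.u.a₂ * y.u.a₂ - x.u.b₁ * y.u.b₂
  b₁ : z.u.b₁ = x.aStar₁ * y.u.b₁ + x.u.b₁ * y.u.a₁
  b₂ : z.u.b₂ = x.aStar₂ * y.u.b₂ + x.u.b₂ * y.u.a₂
  c₁ : z.u.c₁ = x.u.c₁ * y.u.c₁
  c₂ : z.u.c₂ = x.u.c₂ * y.u.c₂
  d₁ : z.d₁ = y.d₁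
  d₂ : z.d₂ = y.d₂

end NonFreeFermionic

/-- The free-fermionic group `GL(2, ℂ) × GL(1, ℂ)`. -/
abbrev FreeFermionic : Type := Matrix.GeneralLinearGroup (Fin 2) ℂ × ℂˣ

/-- The free-fermionic six-vertex matrix attached to `([[a₁, -b₂], [b₁, a₂]], c₁)`, where
`c₂ = (a₁ a₂ + b₁ b₂) / c₁`. -/
def FreeFermionic.weights (g : FreeFermionic) : SixVertex where
  a₁ := g.1 0 0
  a₂ := g.1 1 1
  b₁ := g.1 1 0
  b₂ := -g.1 0 1
  c₁ := g.2
  c₂ := (g.1 0 0 * g.1 1 1 + g.1 1 0 * -g.1 0 1) / g.2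
  c₁_ne := g.2.ne_zero
  c₂_ne := by
    refine div_ne_zero ?_ g.2.ne_zero
    have h : (g.1 : Matrix (Fin 2) (Fin 2) ℂ).det ≠ 0 := by
      rw [← Matrix.GeneralLinearGroup.val_det_apply]
      exact (Matrix.GeneralLinearGroup.det g.1).ne_zero
    rw [Matrix.det_fin_two] at h
    intro h'
    exact h (by linear_combination h')

/-- The underlying set of the six-vertex groupoid: the disjoint union of the free-fermionic and the
non-free-fermionic parts. -/
abbrev SixVertexGroupoid : Type := FreeFermionic ⊕ NonFreeFermionic

namespace SixVertexGroupoid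

/-- The parametrization `π` of six-vertex matrices. -/
def toEnd : SixVertexGroupoid → Module.End ℂ ((Fin 2 → ℂ) ⊗[ℂ] (Fin 2 → ℂ))
  | .inl g => g.weights.toEnd
  | .inr x => x.u.toEnd

/-- The object map `Δ`: it takes values in `(ℂˣ)²` on the non-free-fermionic part, and the
free-fermionic part, a group, lies over the single object `(0, 0)`. -/
def obj : SixVertexGroupoid → ℂ × ℂ
  | .inl _ => (0, 0)
  | .inr x => (x.d₁, x.d₂)

/-- The six-vertex groupoid: the disjoint union of the group `GL(2, ℂ) × GL(1, ℂ)` and a groupoid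
structure on the non-free-fermionic part. -/
def groupoid (Γnf : PartialGroupoid NonFreeFermionic) : PartialGroupoid SixVertexGroupoid :=
  (PartialGroupoid.ofGroup FreeFermionic).sum Γnf

end SixVertexGroupoid

end

/-!
Applying both sides of the Yang–Baxter equation to the product basis turns `⟦u, w, v⟧ = 0` into
scalar equations. They say that, up to a common nonzero factor `k`, the weights `a₁, a₂, c₁,
c₂` of `w` are given by explicit polynomials in the weights of `u` and `v`, while each of `b₁(w)`,
`b₂(w)` is constrained by two linear equations (`SixVertex.ybCommutator_eq_zero_iff`). In general
position the two equations for `b₁(w)` are compatible if and only if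
`a₁(u) b₁(u) N(v) = a₂(v) b₁(v) N(u)`, and similarly for `b₂(w)`. So `N(u)` and `N(v)` vanish
simultaneously. If neither vanishes, the relations say that `Δ(u) = Δ(v')`; the solution `w` is then
unique up to a scalar and is the composition. If both vanish there is no further condition, and the
composition is matrix multiplication in `GL(2, ℂ) × ℂˣ`.

On the non-free-fermionic part, `Δ(x) = Δ(y')` is equivalent to four polynomial relations, uniform
over all the strata (`NonFreeFermionic.Composable`). Under them `x ↦ [[a₁, -b₂], [b₁, a₁*]]` is
multiplicative, with determinant `c₁ c₂`, and likewise `x ↦ [[a₂, -b₁], [b₂, a₂*]]`. This gives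
closure under composition and the groupoid axioms. No case distinction over strata is needed for
closure, because a triple `(u, d₁, d₂)` with `d₁, d₂` invertible and
`a₁ b₁ d₁ = a₂ b₂ d₂ = N(u)` automatically has `u` in `OmegaBar`
(`NonFreeFermionic.mem_omegaBar`).
-/

noncomputable section

/-! ### The Yang–Baxter equation in terms of the weights -/

theorem ybCommutator_apply {V : Type*} [AddCommGroup V] [Module ℂ V]
    (r s t : Module.End ℂ (V ⊗[ℂ] V)) (x : (V ⊗[ℂ] V) ⊗[ℂ] V) :
    ybCommutator r s t x =
      r.rTensor V ((TensorProduct.assoc ℂ V V V).symm (s.lTensor V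
        (TensorProduct.assoc ℂ V V V (t.rTensor V x)))) -
      (TensorProduct.assoc ℂ V V V).symm (t.lTensor V (TensorProduct.assoc ℂ V V V
        (s.rTensor V ((TensorProduct.assoc ℂ V V V).symm (r.lTensor V
          (TensorProduct.assoc ℂ V V V x)))))) := rfl

theorem ybCommutator_smul {V : Type*} [AddCommGroup V] [Module ℂ V] (k : ℂ)
    (r s t : Module.End ℂ (V ⊗[ℂ] V)) :
    ybCommutator r (k • s) t = k • ybCommutator r s t := by
  refine LinearMap.ext fun x => ?_
  simp only [LinearMap.smul_apply, ybCommutator_apply, LinearMap.lTensor_smul,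
    LinearMap.rTensor_smul, map_smul, smul_sub]

namespace SixVertex

theorem toEnd_basis (u : SixVertex) (i j : Fin 2) :
    u.toEnd (Pi.single i 1 ⊗ₜ Pi.single j 1) =
      ∑ p : Fin 2 × Fin 2, u.toMatrix (finProdFinEquiv p) (finProdFinEquiv (i, j)) •
        (Pi.single p.1 (1 : ℂ) ⊗ₜ[ℂ] Pi.single p.2 (1 : ℂ)) := by
  have h := Matrix.toLin_self ((Pi.basisFun ℂ (Fin 2)).tensorProduct (Pi.basisFun ℂ (Fin 2)))
    ((Pi.basisFun ℂ (Fin 2)).tensorProduct (Pi.basisFun ℂ (Fin 2)))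
    (u.toMatrix.submatrix finProdFinEquiv finProdFinEquiv) (i, j)
  simp only [Module.Basis.tensorProduct_apply', Pi.basisFun_apply, Matrix.submatrix_apply] at h
  exact h

/-- The `i`-th standard basis vector of `ℂ²`. -/
def stdVec (i : Fin 2) : Fin 2 → ℂ := Pi.single i 1

theorem toEnd_stdVec_zero_zero (u : SixVertex) :
    u.toEnd (stdVec 0 ⊗ₜ stdVec 0) = u.a₁ • (stdVec 0 ⊗ₜ[ℂ] stdVec 0) := by
  refine (u.toEnd_basis 0 0).trans ?_
  simp [Fintype.sum_prod_type, finProdFinEquiv, toMatrix, stdVec]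

theorem toEnd_stdVec_zero_one (u : SixVertex) :
    u.toEnd (stdVec 0 ⊗ₜ stdVec 1) =
      u.c₁ • (stdVec 0 ⊗ₜ[ℂ] stdVec 1) + u.b₂ • (stdVec 1 ⊗ₜ[ℂ] stdVec 0) := by
  refine (u.toEnd_basis 0 1).trans ?_
  simp [Fintype.sum_prod_type, finProdFinEquiv, toMatrix, stdVec]

theorem toEnd_stdVec_one_zero (u : SixVertex) :
    u.toEnd (stdVec 1 ⊗ₜ stdVec 0) =
      u.b₁ • (stdVec 0 ⊗ₜ[ℂ] stdVec 1) + u.c₂ • (stdVec 1 ⊗ₜ[ℂ] stdVec 0) := by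
  refine (u.toEnd_basis 1 0).trans ?_
  simp [Fintype.sum_prod_type, finProdFinEquiv, toMatrix, stdVec]

theorem toEnd_stdVec_one_one (u : SixVertex) :
    u.toEnd (stdVec 1 ⊗ₜ stdVec 1) = u.a₂ • (stdVec 1 ⊗ₜ[ℂ] stdVec 1) := by
  refine (u.toEnd_basis 1 1).trans ?_
  simp [Fintype.sum_prod_type, finProdFinEquiv, toMatrix, stdVec]

theorem toEnd_eq_smul_iff (u v : SixVertex) (k : ℂ) :
    u.toEnd = k • v.toEnd ↔ u.a₁ = k * v.a₁ ∧ u.a₂ = k * v.a₂ ∧ u.b₁ = k * v.b₁ ∧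
      u.b₂ = k * v.b₂ ∧ u.c₁ = k * v.c₁ ∧ u.c₂ = k * v.c₂ := by
  rw [toEnd, toEnd, ← map_smul, (Matrix.toLin _ _).injective.eq_iff]
  constructor
  · intro h
    have e (i j : Fin 2 × Fin 2) := congrFun (congrFun h i) j
    exact ⟨by simpa [finProdFinEquiv, toMatrix] using e (0, 0) (0, 0),
      by simpa [finProdFinEquiv, toMatrix] using e (1, 1) (1, 1),
      by simpa [finProdFinEquiv, toMatrix] using e (0, 1) (1, 0),
      by simpa [finProdFinEquiv, toMatrix] using e (1, 0) (0, 1),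
      by simpa [finProdFinEquiv, toMatrix] using e (0, 1) (0, 1),
      by simpa [finProdFinEquiv, toMatrix] using e (1, 0) (1, 0)⟩
  · rintro ⟨h₁, h₂, h₃, h₄, h₅, h₆⟩
    ext ⟨i, i'⟩ ⟨j, j'⟩
    fin_cases i <;> fin_cases i' <;> fin_cases j <;> fin_cases j' <;>
      simp [finProdFinEquiv, toMatrix, h₁, h₂, h₃, h₄, h₅, h₆]

theorem toEnd_injective : Function.Injective toEnd := by
  intro u v h
  obtain ⟨h₁, h₂, h₃, h₄, h₅, h₆⟩ := (u.toEnd_eq_smul_iff v 1).1 (by rw [h, one_smul])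
  exact SixVertex.ext (by simpa using h₁) (by simpa using h₂) (by simpa using h₃)
    (by simpa using h₄) (by simpa using h₅) (by simpa using h₆)

/-- `w` is `k` times the normalized solution of the Yang–Baxter equation `⟦u, w, v⟧ = 0`. The
weights `b₁` and `b₂` of `w` are each constrained by two equations; their compatibility is what
restricts the pairs `(u, v)` for which a solution exists. -/
structure IsScaledSolution (k : ℂ) (u w v : SixVertex) : Prop where
  c₁ : w.c₁ = k * (u.c₁ * v.c₁)
  c₂ : w.c₂ = k * (u.c₂ * v.c₂)
  a₁ : w.a₁ = k * (u.a₁ * v.a₁ - u.b₂ * v.b₁)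
  a₂ : w.a₂ = k * (u.a₂ * v.a₂ - u.b₁ * v.b₂)
  b₁_left : u.a₁ * w.b₁ = k * (u.a₁ * v.a₁ * u.b₁ + u.detB * v.b₁)
  b₁_right : v.a₂ * w.b₁ = k * (u.a₂ * v.a₂ * v.b₁ + v.detB * u.b₁)
  b₂_left : u.a₂ * w.b₂ = k * (u.a₂ * v.a₂ * u.b₂ + u.detB * v.b₂)
  b₂_right : v.a₁ * w.b₂ = k * (u.a₁ * v.a₁ * v.b₂ + v.detB * u.b₂)

/-- The coordinate of a tensor in `V ⊗ V ⊗ V` along a product basis vector. -/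
def coord (i j k : Fin 2) : (((Fin 2 → ℂ) ⊗[ℂ] (Fin 2 → ℂ)) ⊗[ℂ] (Fin 2 → ℂ)) →ₗ[ℂ] ℂ :=
  (((Pi.basisFun ℂ (Fin 2)).tensorProduct (Pi.basisFun ℂ (Fin 2))).tensorProduct
    (Pi.basisFun ℂ (Fin 2))).coord ((i, j), k)

theorem coord_stdVec (i j k l m n : Fin 2) :
    coord i j k ((stdVec l ⊗ₜ stdVec m) ⊗ₜ stdVec n) =
      if i = l ∧ j = m ∧ k = n then 1 else 0 := by
  simp only [coord, stdVec, Module.Basis.coord_apply, Module.Basis.tensorProduct_repr_tmul_apply,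
    Pi.basisFun_repr, Pi.single_apply, smul_eq_mul]
  split_ifs <;> simp_all

/-- The matrix entry of `⟦u, w, v⟧` in the product basis. -/
def ybEntry (u w v : SixVertex) (i j k l m n : Fin 2) : ℂ :=
  coord i j k (ybCommutator u.toEnd w.toEnd v.toEnd ((stdVec l ⊗ₜ stdVec m) ⊗ₜ stdVec n))

theorem ybCommutator_eq_zero_iff_entries (u w v : SixVertex) :
    ybCommutator u.toEnd w.toEnd v.toEnd = 0 ↔
      ∀ i j k l m n, ybEntry u w v i j k l m n = 0 := by
  constructor
  · intro h i j k l m n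
    rw [ybEntry, h, LinearMap.zero_apply, map_zero]
  · intro h
    let B := (((Pi.basisFun ℂ (Fin 2)).tensorProduct (Pi.basisFun ℂ (Fin 2))).tensorProduct
      (Pi.basisFun ℂ (Fin 2)))
    refine B.ext fun p => B.repr.injective (Finsupp.ext fun q => ?_)
    have := h q.1.1 q.1.2 q.2 p.1.1 p.1.2 p.2
    simpa [B, ybEntry, coord, stdVec, Module.Basis.tensorProduct_apply'] using this

/-- The Yang–Baxter equation for six-vertex matrices in terms of weights. The entry of `⟦u, w, v⟧`
at `e₁ ⊗ e₂ ⊗ e₁` fixes the ratio of `c₁(w)` to `c₂(w)`, and the scalar is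
`k = c₁(w) / (c₁(u) c₁(v))`. -/
theorem ybCommutator_eq_zero_iff (u w v : SixVertex) :
    ybCommutator u.toEnd w.toEnd v.toEnd = 0 ↔ ∃ k : ℂ, k ≠ 0 ∧ IsScaledSolution k u w v := by
  rw [ybCommutator_eq_zero_iff_entries]
  simp only [ybEntry, Fin.forall_fin_two, ybCommutator_apply, LinearMap.rTensor_tmul,
    LinearMap.lTensor_tmul, toEnd_stdVec_zero_zero, toEnd_stdVec_zero_one, toEnd_stdVec_one_zero,
    toEnd_stdVec_one_one, TensorProduct.add_tmul, TensorProduct.tmul_add,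
    ← TensorProduct.smul_tmul', TensorProduct.tmul_smul, map_add, map_smul, map_sub,
    TensorProduct.assoc_tmul, TensorProduct.assoc_symm_tmul, coord_stdVec]
  simp only [zero_ne_one, one_ne_zero, and_true, true_and, and_false, and_self,
    if_true, if_false, smul_eq_mul, mul_one, mul_zero, add_zero, zero_add, sub_self]
  constructor
  · rintro ⟨⟨⟨-, ⟨e₁, e₂⟩, -⟩, ⟨⟨e₃, e₄⟩, -⟩, f₁, f₂, -⟩, ⟨-, f₃, -⟩, -⟩
    have hu := u.c₁_ne
    have hv := v.c₁_ne
    refine ⟨w.c₁ / (u.c₁ * v.c₁), div_ne_zero w.c₁_ne (mul_ne_zero hu hv), ?_, ?_, ?_, ?_, ?_, ?_,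
      ?_, ?_⟩ <;> field_simp
    · linear_combination e₄
    · linear_combination -e₁
    · linear_combination f₁
    · rw [detB]; linear_combination u.c₁ * e₂ - u.b₁ * e₁
    · rw [detB]; linear_combination v.b₁ * f₁ - v.c₁ * f₂
    · rw [detB]; linear_combination u.b₂ * f₁ - u.c₁ * f₃
    · rw [detB]; linear_combination v.c₁ * e₃ - v.b₂ * e₁
  · rintro ⟨k, -, h⟩
    have h₁ := h.b₁_left
    have h₂ := h.b₁_right
    have h₃ := h.b₂_left
    have h₄ := h.b₂_right
    simp only [detB] at h₁ h₂ h₃ h₄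
    simp only [h.c₁, h.c₂, h.a₁, h.a₂]
    refine ⟨⟨⟨?_, ⟨?_, ?_⟩, ?_⟩, ⟨⟨?_, ?_⟩, ?_⟩, ?_, ?_, ?_⟩,
      ⟨⟨⟨?_, ?_⟩, ?_⟩, ?_, ?_, ?_⟩, ⟨?_, ?_, ?_⟩, ?_⟩
    · ring
    · ring
    · linear_combination v.c₁ * h₁
    · ring
    · linear_combination u.c₁ * h₄
    · ring
    · linear_combination -v.c₂ * h₁
    · ring
    · linear_combination -u.c₁ * h₂
    · ring
    · ring
    · linear_combination -u.c₂ * h₄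
    · ring
    · linear_combination -v.c₁ * h₃
    · ring
    · linear_combination u.c₂ * h₂
    · ring
    · linear_combination v.c₂ * h₃
    · ring
    · ring

end SixVertex
/-! ### Strata and object coordinates -/

namespace NonFreeFermionic

theorem ext_weights {x y : NonFreeFermionic} (a₁ : x.u.a₁ = y.u.a₁) (a₂ : x.u.a₂ = y.u.a₂)
    (b₁ : x.u.b₁ = y.u.b₁) (b₂ : x.u.b₂ = y.u.b₂) (c₁ : x.u.c₁ = y.u.c₁) (c₂ : x.u.c₂ = y.u.c₂)
    (d₁ : (x.d₁ : ℂ) = y.d₁) (d₂ : (x.d₂ : ℂ) = y.d₂) : x = y :=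
  NonFreeFermionic.ext (SixVertex.ext a₁ a₂ b₁ b₂ c₁ c₂) (Units.ext d₁) (Units.ext d₂)

/-- Membership in `OmegaBar` is automatic: `d₁` and `d₂` are invertible, so if `N(u) = 0` then
`a₁ b₁ = a₂ b₂ = 0`, and `c₁ c₂ ≠ 0` leaves only the two boundary strata. -/
theorem mem_omegaBar (u : SixVertex) (d₁ d₂ : ℂˣ) (h₁ : u.a₁ * u.b₁ * d₁ = u.N)
    (h₂ : u.a₂ * u.b₂ * d₂ = u.N) : u ∈ SixVertex.OmegaBar := by
  have hc : u.c₁ * u.c₂ ≠ 0 := mul_ne_zero u.c₁_ne u.c₂_ne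
  by_cases hN : u.N = 0
  · have h₁' : u.a₁ * u.b₁ = 0 := by simpa [hN] using h₁
    have h₂' : u.a₂ * u.b₂ = 0 := by simpa [hN] using h₂
    rw [SixVertex.N] at hN
    rcases mul_eq_zero.1 h₁' with h | h <;> rcases mul_eq_zero.1 h₂' with h' | h'
    · have hb : u.b₁ * u.b₂ = u.c₁ * u.c₂ := by linear_combination hN - u.a₂ * h
      rw [← hb] at hc
      exact .inl (.inr ⟨left_ne_zero_of_mul hc, right_ne_zero_of_mul hc, h, h',
        sub_eq_zero.2 hb⟩)
    · exact absurd (by linear_combination -hN + u.a₂ * h + u.b₁ * h') hc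
    · exact absurd (by linear_combination -hN + u.b₂ * h + u.a₁ * h') hc
    · have ha : u.a₁ * u.a₂ = u.c₁ * u.c₂ := by linear_combination hN - u.b₂ * h
      rw [← ha] at hc
      exact .inl (.inl (.inr ⟨left_ne_zero_of_mul hc, right_ne_zero_of_mul hc, h, h',
        sub_eq_zero.2 ha⟩))
  · have hg : u.IsGeneric := by
      have h₁' := hN
      have h₂' := hN
      rw [← h₁] at h₁'
      rw [← h₂] at h₂'
      simp only [mul_ne_zero_iff] at h₁' h₂'
      exact ⟨h₁'.1.1, h₂'.1.1, h₁'.1.2, h₂'.1.2⟩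
    by_cases hB : u.detB = 0
    · exact .inr ⟨hg, hN, hB⟩
    · exact .inl (.inl (.inl ⟨hg, hB, hN⟩))

theorem a_ne_zero_or (x : NonFreeFermionic) :
    (x.u.a₁ ≠ 0 ∧ x.u.a₂ ≠ 0) ∨ (x.u.a₁ = 0 ∧ x.u.a₂ = 0 ∧ x.u.b₁ ≠ 0 ∧ x.u.b₂ ≠ 0) := by
  rcases x.mem with ((h | h) | h) | h
  · exact .inl ⟨h.1.1, h.1.2.1⟩
  · exact .inl ⟨h.1, h.2.1⟩
  · exact .inr ⟨h.2.2.1, h.2.2.2.1, h.1, h.2.1⟩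
  · exact .inl ⟨h.1.1, h.1.2.1⟩

theorem a₁_mul_aStar₁ (x : NonFreeFermionic) :
    x.u.a₁ * x.aStar₁ = x.u.c₁ * x.u.c₂ - x.u.b₁ * x.u.b₂ := by
  have h := x.eq₁
  simp only [aStar₁, SixVertex.N] at *
  linear_combination -h

theorem a₂_mul_aStar₂ (x : NonFreeFermionic) :
    x.u.a₂ * x.aStar₂ = x.u.c₁ * x.u.c₂ - x.u.b₁ * x.u.b₂ := by
  have h := x.eq₂
  simp only [aStar₂, SixVertex.N] at *
  linear_combination -h

theorem b₁_mul_d₁ (x : NonFreeFermionic) : x.u.b₁ * x.d₁ = x.u.a₂ - x.aStar₁ := by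
  rw [aStar₁]; ring

theorem b₂_mul_d₂ (x : NonFreeFermionic) : x.u.b₂ * x.d₂ = x.u.a₁ - x.aStar₂ := by
  rw [aStar₂]; ring

/-- The first object coordinate of the inverse of `x`. -/
def invD₁ (x : NonFreeFermionic) : ℂ :=
  if x.u.a₁ = 0 then x.u.b₂ / x.u.b₁ * x.d₂ else x.u.a₁ / x.u.a₂ * x.d₁

/-- The second object coordinate of the inverse of `x`. -/
def invD₂ (x : NonFreeFermionic) : ℂ :=
  if x.u.a₁ = 0 then x.u.b₁ / x.u.b₂ * x.d₁ else x.u.a₂ / x.u.a₁ * x.d₂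

theorem invD₁_ne_zero (x : NonFreeFermionic) : x.invD₁ ≠ 0 := by
  rcases x.a_ne_zero_or with ⟨h₁, h₂⟩ | ⟨h₁, -, h₂, h₃⟩
  · rw [invD₁, if_neg h₁]
    exact mul_ne_zero (div_ne_zero h₁ h₂) x.d₁.ne_zero
  · rw [invD₁, if_pos h₁]
    exact mul_ne_zero (div_ne_zero h₃ h₂) x.d₂.ne_zero

theorem invD₂_ne_zero (x : NonFreeFermionic) : x.invD₂ ≠ 0 := by
  rcases x.a_ne_zero_or with ⟨h₁, h₂⟩ | ⟨h₁, -, h₂, h₃⟩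
  · rw [invD₂, if_neg h₁]
    exact mul_ne_zero (div_ne_zero h₂ h₁) x.d₂.ne_zero
  · rw [invD₂, if_pos h₁]
    exact mul_ne_zero (div_ne_zero h₂ h₃) x.d₁.ne_zero

/-- The case distinction in `invD₁` disappears when the two linear relations satisfied by the
inverse coordinate are imposed together. -/
theorem eq_invD₁_iff (x : NonFreeFermionic) (d : ℂ) :
    d = x.invD₁ ↔ x.u.a₂ * d = x.u.a₁ * x.d₁ ∧ x.u.b₁ * d = x.u.b₂ * x.d₂ := by
  have h : x.u.a₁ * x.u.b₁ * x.d₁ = x.u.a₂ * x.u.b₂ * x.d₂ := x.eq₁.trans x.eq₂.symm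
  rcases x.a_ne_zero_or with ⟨h₁, h₂⟩ | ⟨h₁, h₂, h₃, h₄⟩
  · rw [invD₁, if_neg h₁, div_mul_eq_mul_div, eq_div_iff h₂, mul_comm d]
    refine ⟨fun e => ⟨e, mul_left_cancel₀ h₂ ?_⟩, And.left⟩
    linear_combination x.u.b₁ * e + h
  · rw [invD₁, if_pos h₁, div_mul_eq_mul_div, eq_div_iff h₃, mul_comm d]
    simp [h₁, h₂]

theorem eq_invD₂_iff (x : NonFreeFermionic) (d : ℂ) :
    d = x.invD₂ ↔ x.u.a₁ * d = x.u.a₂ * x.d₂ ∧ x.u.b₂ * d = x.u.b₁ * x.d₁ := by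
  have h : x.u.a₁ * x.u.b₁ * x.d₁ = x.u.a₂ * x.u.b₂ * x.d₂ := x.eq₁.trans x.eq₂.symm
  rcases x.a_ne_zero_or with ⟨h₁, h₂⟩ | ⟨h₁, h₂, h₃, h₄⟩
  · rw [invD₂, if_neg h₁, div_mul_eq_mul_div, eq_div_iff h₁, mul_comm d]
    refine ⟨fun e => ⟨e, mul_left_cancel₀ h₁ ?_⟩, And.left⟩
    linear_combination x.u.b₂ * e - h
  · rw [invD₂, if_pos h₁, div_mul_eq_mul_div, eq_div_iff h₄, mul_comm d]
    simp [h₁, h₂]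

/-! ### Composition and inverse -/

/-- `x ⋆ y` is defined. These four relations, linear in `y`, say that `Δ(x) = Δ(y')`; see
`composable_iff`. -/
structure Composable (x y : NonFreeFermionic) : Prop where
  a₁ : y.u.a₁ * x.d₂ = y.u.a₂ * y.d₂
  a₂ : y.u.a₂ * x.d₁ = y.u.a₁ * y.d₁
  b₁ : y.u.b₁ * x.d₁ = y.u.b₂ * y.d₂
  b₂ : y.u.b₂ * x.d₂ = y.u.b₁ * y.d₁

theorem composable_iff (x y : NonFreeFermionic) :
    x.Composable y ↔ (x.d₁ : ℂ) = y.invD₁ ∧ (x.d₂ : ℂ) = y.invD₂ := by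
  rw [eq_invD₁_iff, eq_invD₂_iff]
  exact ⟨fun h => ⟨⟨h.a₂, h.b₁⟩, h.a₁, h.b₂⟩, fun h => ⟨h.2.1, h.1.1, h.1.2, h.2.2⟩⟩

/-- The weights of the composition of `x` and `y`. -/
def compWeights (x y : NonFreeFermionic) : SixVertex where
  a₁ := x.u.a₁ * y.u.a₁ - x.u.b₂ * y.u.b₁
  a₂ := x.u.a₂ * y.u.a₂ - x.u.b₁ * y.u.b₂
  b₁ := x.aStar₁ * y.u.b₁ + x.u.b₁ * y.u.a₁
  b₂ := x.aStar₂ * y.u.b₂ + x.u.b₂ * y.u.a₂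
  c₁ := x.u.c₁ * y.u.c₁
  c₂ := x.u.c₂ * y.u.c₂
  c₁_ne := mul_ne_zero x.u.c₁_ne y.u.c₁_ne
  c₂_ne := mul_ne_zero x.u.c₂_ne y.u.c₂_ne

theorem compWeights_aStar₁ {x y : NonFreeFermionic} (h : x.Composable y) :
    (compWeights x y).a₂ - y.d₁ * (compWeights x y).b₁ =
      x.aStar₁ * y.aStar₁ - x.u.b₁ * y.u.b₂ := by
  simp only [compWeights, aStar₁]
  linear_combination x.u.b₁ * h.a₂

theorem compWeights_aStar₂ {x y : NonFreeFermionic} (h : x.Composable y) :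
    (compWeights x y).a₁ - y.d₂ * (compWeights x y).b₂ =
      x.aStar₂ * y.aStar₂ - x.u.b₂ * y.u.b₁ := by
  simp only [compWeights, aStar₂]
  linear_combination x.u.b₂ * h.a₁

theorem compWeights_b₁ {x y : NonFreeFermionic} (h : x.Composable y) :
    (compWeights x y).b₁ = x.u.a₂ * y.u.b₁ + x.u.b₁ * y.aStar₂ := by
  simp only [compWeights, aStar₁, aStar₂]
  linear_combination -x.u.b₁ * h.b₁

theorem compWeights_b₂ {x y : NonFreeFermionic} (h : x.Composable y) :
    (compWeights x y).b₂ = x.u.a₁ * y.u.b₂ + x.u.b₂ * y.aStar₁ := by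
  simp only [compWeights, aStar₁, aStar₂]
  linear_combination -x.u.b₂ * h.b₂

/-- The matrices `[[a₁, -b₂], [b₁, a₁*]]` have determinant `c₁ c₂`, and under composition they
multiply: the second column of the product is given by `compWeights_b₂` and
`compWeights_aStar₁`. -/
theorem compWeights_eq₁ {x y : NonFreeFermionic} (h : x.Composable y) :
    (compWeights x y).a₁ * (compWeights x y).b₁ * y.d₁ = (compWeights x y).N := by
  have h₁ := compWeights_aStar₁ h
  have h₂ := compWeights_b₂ h
  have hx := x.a₁_mul_aStar₁
  have hy := y.a₁_mul_aStar₁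
  rw [SixVertex.N]
  simp only [compWeights] at h₁ h₂ ⊢
  linear_combination (-(x.u.a₁ * y.u.a₁ - x.u.b₂ * y.u.b₁)) * h₁
    - (x.aStar₁ * y.u.b₁ + x.u.b₁ * y.u.a₁) * h₂ - (y.u.c₁ * y.u.c₂) * hx
    - (x.u.a₁ * x.aStar₁ + x.u.b₁ * x.u.b₂) * hy

/-- As for `compWeights_eq₁`, with the matrices `[[a₂, -b₁], [b₂, a₂*]]`. -/
theorem compWeights_eq₂ {x y : NonFreeFermionic} (h : x.Composable y) :
    (compWeights x y).a₂ * (compWeights x y).b₂ * y.d₂ = (compWeights x y).N := by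
  have h₁ := compWeights_aStar₂ h
  have h₂ := compWeights_b₁ h
  have hx := x.a₂_mul_aStar₂
  have hy := y.a₂_mul_aStar₂
  rw [SixVertex.N]
  simp only [compWeights] at h₁ h₂ ⊢
  linear_combination (-(x.u.a₂ * y.u.a₂ - x.u.b₁ * y.u.b₂)) * h₁
    - (x.aStar₂ * y.u.b₂ + x.u.b₂ * y.u.a₂) * h₂ - (y.u.c₁ * y.u.c₂) * hx
    - (x.u.a₂ * x.aStar₂ + x.u.b₁ * x.u.b₂) * hy

/-- The composition `x ⋆ y`. -/
def comp (x y : NonFreeFermionic) (h : x.Composable y) : NonFreeFermionic where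
  u := compWeights x y
  d₁ := y.d₁
  d₂ := y.d₂
  mem := mem_omegaBar _ _ _ (compWeights_eq₁ h) (compWeights_eq₂ h)
  eq₁ := compWeights_eq₁ h
  eq₂ := compWeights_eq₂ h

/-- The weights of the inverse of `x`. -/
def invWeights (x : NonFreeFermionic) : SixVertex where
  a₁ := x.aStar₁ / (x.u.c₁ * x.u.c₂)
  a₂ := x.aStar₂ / (x.u.c₁ * x.u.c₂)
  b₁ := -x.u.b₁ / (x.u.c₁ * x.u.c₂)
  b₂ := -x.u.b₂ / (x.u.c₁ * x.u.c₂)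
  c₁ := x.u.c₂ / (x.u.c₁ * x.u.c₂)
  c₂ := x.u.c₁ / (x.u.c₁ * x.u.c₂)
  c₁_ne := div_ne_zero x.u.c₂_ne (mul_ne_zero x.u.c₁_ne x.u.c₂_ne)
  c₂_ne := div_ne_zero x.u.c₁_ne (mul_ne_zero x.u.c₁_ne x.u.c₂_ne)

theorem invWeights_eq₁ (x : NonFreeFermionic) :
    x.invWeights.a₁ * x.invWeights.b₁ * x.invD₁ = x.invWeights.N := by
  have h₁ := x.u.c₁_ne
  have h₂ := x.u.c₂_ne
  have h := x.a₁_mul_aStar₁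
  have e := ((x.eq_invD₁_iff _).1 rfl).2
  have e' := x.b₂_mul_d₂
  simp only [invWeights, SixVertex.N]
  field_simp
  linear_combination -x.aStar₁ * e - x.aStar₁ * e' - h

theorem invWeights_eq₂ (x : NonFreeFermionic) :
    x.invWeights.a₂ * x.invWeights.b₂ * x.invD₂ = x.invWeights.N := by
  have h₁ := x.u.c₁_ne
  have h₂ := x.u.c₂_ne
  have h := x.a₂_mul_aStar₂
  have e := ((x.eq_invD₂_iff _).1 rfl).2
  have e' := x.b₁_mul_d₁
  simp only [invWeights, SixVertex.N]
  field_simp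
  linear_combination -x.aStar₂ * e - x.aStar₂ * e' - h

instance : Inv NonFreeFermionic where
  inv x :=
    { u := x.invWeights
      d₁ := Units.mk0 x.invD₁ x.invD₁_ne_zero
      d₂ := Units.mk0 x.invD₂ x.invD₂_ne_zero
      mem := mem_omegaBar x.invWeights (Units.mk0 x.invD₁ x.invD₁_ne_zero)
        (Units.mk0 x.invD₂ x.invD₂_ne_zero) x.invWeights_eq₁ x.invWeights_eq₂
      eq₁ := x.invWeights_eq₁
      eq₂ := x.invWeights_eq₂ }

theorem isInverse_inv (x : NonFreeFermionic) : x.IsInverse x⁻¹ :=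
  ⟨rfl, rfl, rfl, rfl, rfl, rfl, rfl, rfl⟩

theorem isComposition_comp {x y : NonFreeFermionic} (h : x.Composable y) :
    x.IsComposition y (comp x y h) :=
  ⟨rfl, rfl, rfl, rfl, rfl, rfl, rfl, rfl⟩

theorem inv_composable (x : NonFreeFermionic) : x⁻¹.Composable x :=
  (composable_iff _ _).2 ⟨rfl, rfl⟩

theorem aStar₁_inv (x : NonFreeFermionic) : x⁻¹.aStar₁ = x.u.a₁ / (x.u.c₁ * x.u.c₂) := by
  have h := x.inv_composable.b₁
  rw [aStar₁, x.isInverse_inv.a₂, x.isInverse_inv.b₁, aStar₂]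
  linear_combination (x.u.c₁ * x.u.c₂)⁻¹ * h

theorem aStar₂_inv (x : NonFreeFermionic) : x⁻¹.aStar₂ = x.u.a₂ / (x.u.c₁ * x.u.c₂) := by
  have h := x.inv_composable.b₂
  rw [aStar₂, x.isInverse_inv.a₁, x.isInverse_inv.b₂, aStar₁]
  linear_combination (x.u.c₁ * x.u.c₂)⁻¹ * h

theorem composable_inv (x : NonFreeFermionic) : x.Composable x⁻¹ := by
  have h := x.inv_composable
  have hi := x.isInverse_inv
  constructor
  · rw [hi.a₁, hi.a₂, div_mul_eq_mul_div, div_mul_eq_mul_div]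
    congr 1
    simp only [aStar₁, aStar₂]
    linear_combination -h.a₁ + x.d₂ * h.b₂
  · rw [hi.a₁, hi.a₂, div_mul_eq_mul_div, div_mul_eq_mul_div]
    congr 1
    simp only [aStar₁, aStar₂]
    linear_combination -h.a₂ + x.d₁ * h.b₁
  · rw [hi.b₁, hi.b₂, div_mul_eq_mul_div, div_mul_eq_mul_div]
    congr 1
    linear_combination h.b₂
  · rw [hi.b₁, hi.b₂, div_mul_eq_mul_div, div_mul_eq_mul_div]
    congr 1
    linear_combination h.b₁

theorem Composable.comp_left {x y z : NonFreeFermionic} (h : x.Composable y)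
    (h' : y.Composable z) : (comp x y h).Composable z :=
  ⟨h'.a₁, h'.a₂, h'.b₁, h'.b₂⟩

theorem Composable.comp_right {x y z : NonFreeFermionic} (h : x.Composable y)
    (h' : y.Composable z) : x.Composable (comp y z h') := by
  constructor <;> simp only [comp, compWeights, aStar₁, aStar₂]
  · linear_combination z.u.a₁ * h.a₁ - z.u.b₁ * h.b₂ + y.u.a₂ * h'.a₁ - y.u.b₁ * h'.b₁
  · linear_combination z.u.a₂ * h.a₂ - z.u.b₂ * h.b₁ + y.u.a₁ * h'.a₂ - y.u.b₂ * h'.b₂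
  · linear_combination z.u.b₁ * h.a₂ - (z.u.b₁ * y.d₁) * h.b₁ + z.u.a₁ * h.b₁
      + (y.u.a₁ - y.d₂ * y.u.b₂) * h'.b₁ + y.u.b₂ * h'.a₁
  · linear_combination z.u.b₂ * h.a₁ - (z.u.b₂ * y.d₂) * h.b₂ + z.u.a₂ * h.b₂
      + (y.u.a₂ - y.d₁ * y.u.b₁) * h'.b₂ + y.u.b₁ * h'.a₂

/-! ### The groupoid axioms -/

theorem comp_assoc {x y z : NonFreeFermionic} (h : x.Composable y) (h' : y.Composable z) :
    comp (comp x y h) z (h.comp_left h') = comp x (comp y z h') (h.comp_right h') := by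
  have e₁ := compWeights_b₁ h
  have e₂ := compWeights_b₂ h
  have s₁ := compWeights_aStar₁ h
  have s₂ := compWeights_aStar₂ h
  apply ext_weights
  · simp only [comp, compWeights] at e₂ ⊢
    rw [e₂, aStar₁]
    ring
  · simp only [comp, compWeights] at e₁ ⊢
    rw [e₁, aStar₂]
    ring
  · simp only [comp, compWeights, aStar₁] at s₁ ⊢
    rw [s₁]
    ring
  · simp only [comp, compWeights, aStar₂] at s₂ ⊢
    rw [s₂]
    ring
  · exact mul_assoc _ _ _
  · exact mul_assoc _ _ _
  · rfl
  · rfl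

/-- The matrices attached to `y'` are the inverses of those attached to `y`, so this cancellation
uses the second columns of the product matrices of `x ⋆ y`: `compWeights_b₁`, `compWeights_b₂`,
`compWeights_aStar₁` and `compWeights_aStar₂`. -/
theorem comp_comp_inv {x y : NonFreeFermionic} (h : x.Composable y) :
    comp (comp x y h) y⁻¹ (h.comp_left y.composable_inv) = x := by
  have h₁ := y.u.c₁_ne
  have h₂ := y.u.c₂_ne
  have hd := (composable_iff x y).1 h
  have e₁ := compWeights_b₁ h
  have e₂ := compWeights_b₂ h
  have s₁ := compWeights_aStar₁ h
  have s₂ := compWeights_aStar₂ h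
  have hi := y.isInverse_inv
  have n₁ := y.a₁_mul_aStar₁
  have n₂ := y.a₂_mul_aStar₂
  have hc := isComposition_comp (h.comp_left y.composable_inv)
  apply ext_weights
  · rw [hc.a₁, hi.a₁, hi.b₁]
    simp only [comp]
    rw [e₂]
    simp only [compWeights]
    field_simp
    linear_combination x.u.a₁ * n₁
  · rw [hc.a₂, hi.a₂, hi.b₂]
    simp only [comp]
    rw [e₁]
    simp only [compWeights]
    field_simp
    linear_combination x.u.a₂ * n₂
  · rw [hc.b₁, hi.a₁, hi.b₁, aStar₁]
    simp only [comp]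
    rw [s₁]
    simp only [compWeights]
    field_simp
    linear_combination x.u.b₁ * n₁
  · rw [hc.b₂, hi.a₂, hi.b₂, aStar₂]
    simp only [comp]
    rw [s₂]
    simp only [compWeights]
    field_simp
    linear_combination x.u.b₂ * n₂
  · rw [hc.c₁, hi.c₁]
    simp only [comp, compWeights]
    field_simp
  · rw [hc.c₂, hi.c₂]
    simp only [comp, compWeights]
    field_simp
  · exact hd.1.symm
  · exact hd.2.symm

theorem inv_comp_comp {x y : NonFreeFermionic} (h : x.Composable y) :
    comp x⁻¹ (comp x y h) (x.inv_composable.comp_right h) = y := by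
  have h₁ := x.u.c₁_ne
  have h₂ := x.u.c₂_ne
  have hi := x.isInverse_inv
  have n₁ := x.a₁_mul_aStar₁
  have n₂ := x.a₂_mul_aStar₂
  have hc := isComposition_comp (x.inv_composable.comp_right h)
  apply ext_weights
  · rw [hc.a₁, hi.a₁, hi.b₂]
    simp only [comp, compWeights]
    field_simp
    linear_combination y.u.a₁ * n₁
  · rw [hc.a₂, hi.a₂, hi.b₁]
    simp only [comp, compWeights]
    field_simp
    linear_combination y.u.a₂ * n₂
  · rw [hc.b₁, hi.b₁, aStar₁_inv]
    simp only [comp, compWeights]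
    field_simp
    linear_combination y.u.b₁ * n₁
  · rw [hc.b₂, hi.b₂, aStar₂_inv]
    simp only [comp, compWeights]
    field_simp
    linear_combination y.u.b₂ * n₂
  · rw [hc.c₁, hi.c₁]
    simp only [comp, compWeights]
    field_simp
  · rw [hc.c₂, hi.c₂]
    simp only [comp, compWeights]
    field_simp
  · rfl
  · rfl

/-- The non-free-fermionic groupoid. -/
def groupoid : PartialGroupoid NonFreeFermionic where
  Defined := Composable
  comp := comp
  inv x := x⁻¹
  assoc _ _ _ h h' := ⟨h.comp_left h', h.comp_right h', comp_assoc h h'⟩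
  defined_inv := composable_inv
  inv_defined := inv_composable
  comp_comp_inv _ y h := ⟨h.comp_left y.composable_inv, comp_comp_inv h⟩
  inv_comp_comp x _ h := ⟨x.inv_composable.comp_right h, inv_comp_comp h⟩

/-! ### Compositions solve the Yang–Baxter equation -/

theorem isScaledSolution_comp {x y : NonFreeFermionic} (h : x.Composable y) :
    SixVertex.IsScaledSolution 1 x.u (comp x y h).u y.u := by
  have n₁ := x.a₁_mul_aStar₁
  have n₂ := x.a₂_mul_aStar₂
  have m₁ := y.a₁_mul_aStar₁
  have m₂ := y.a₂_mul_aStar₂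
  constructor
  · simp only [comp, compWeights, one_mul]
  · simp only [comp, compWeights, one_mul]
  · simp only [comp, compWeights, one_mul]
  · simp only [comp, compWeights, one_mul]
  · simp only [comp, compWeights, SixVertex.detB]
    linear_combination y.u.b₁ * n₁
  · simp only [comp, compWeights_b₁ h, SixVertex.detB]
    linear_combination x.u.b₁ * m₂
  · simp only [comp, compWeights, SixVertex.detB]
    linear_combination y.u.b₂ * n₂
  · simp only [comp, compWeights_b₂ h, SixVertex.detB]
    linear_combination x.u.b₂ * m₁

end NonFreeFermionic

theorem FreeFermionic.N_weights (g : FreeFermionic) : g.weights.N = 0 := by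
  have h := g.2.ne_zero
  simp only [SixVertex.N, FreeFermionic.weights]
  field_simp
  ring

theorem FreeFermionic.isScaledSolution_mul (g h : FreeFermionic) :
    SixVertex.IsScaledSolution 1 g.weights (g * h).weights h.weights := by
  have hg := g.2.ne_zero
  have hh := h.2.ne_zero
  constructor <;>
    simp only [FreeFermionic.weights, SixVertex.detB, Prod.fst_mul, Prod.snd_mul,
      Matrix.mul_apply, Fin.sum_univ_two, Units.val_mul] <;>
    field_simp <;> ring

/-! ### Solutions in general position -/

namespace SixVertex

theorem IsScaledSolution.N_eq₁ {k : ℂ} {u w v : SixVertex} (h : IsScaledSolution k u w v)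
    (hk : k ≠ 0) : u.a₁ * u.b₁ * v.N = v.a₂ * v.b₁ * u.N := by
  have h₁ := h.b₁_left
  have h₂ := h.b₁_right
  apply mul_left_cancel₀ hk
  simp only [N, detB] at *
  linear_combination u.a₁ * h₂ - v.a₂ * h₁

theorem IsScaledSolution.N_eq₂ {k : ℂ} {u w v : SixVertex} (h : IsScaledSolution k u w v)
    (hk : k ≠ 0) : u.a₂ * u.b₂ * v.N = v.a₁ * v.b₂ * u.N := by
  have h₁ := h.b₂_left
  have h₂ := h.b₂_right
  apply mul_left_cancel₀ hk
  simp only [N, detB] at *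
  linear_combination u.a₂ * h₂ - v.a₁ * h₁

theorem IsScaledSolution.toEnd_eq {k : ℂ} {u w z v : SixVertex} (hu : u.IsGeneric)
    (hw : IsScaledSolution k u w v) (hz : IsScaledSolution 1 u z v) :
    w.toEnd = k • z.toEnd := by
  rw [toEnd_eq_smul_iff]
  refine ⟨?_, ?_, mul_left_cancel₀ hu.1 ?_, mul_left_cancel₀ hu.2.1 ?_, ?_, ?_⟩
  · rw [hw.a₁, hz.a₁, one_mul]
  · rw [hw.a₂, hz.a₂, one_mul]
  · rw [hw.b₁_left, mul_left_comm, hz.b₁_left, one_mul]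
  · rw [hw.b₂_left, mul_left_comm, hz.b₂_left, one_mul]
  · rw [hw.c₁, hz.c₁, one_mul]
  · rw [hw.c₂, hz.c₂, one_mul]

/-- A generic six-vertex matrix lies in the image of the parametrization: in the free-fermionic part
if `N(u) = 0`, and in the other part with `d₁ = N(u) / (a₁ b₁)` and `d₂ = N(u) / (a₂ b₂)`
otherwise. -/
theorem IsGeneric.exists_toEnd_eq {u : SixVertex} (hu : u.IsGeneric) :
    ∃ g : SixVertexGroupoid, g.toEnd = u.toEnd := by
  by_cases hN : u.N = 0
  · have hd : (!![u.a₁, -u.b₂; u.b₁, u.a₂] : Matrix (Fin 2) (Fin 2) ℂ).det ≠ 0 := by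
      rw [Matrix.det_fin_two_of]
      intro h
      refine mul_ne_zero u.c₁_ne u.c₂_ne ?_
      rw [N] at hN
      linear_combination h - hN
    refine ⟨.inl (Matrix.GeneralLinearGroup.mkOfDetNeZero _ hd, Units.mk0 u.c₁ u.c₁_ne),
      congrArg toEnd ?_⟩
    have hc := u.c₁_ne
    rw [N] at hN
    ext <;> simp [FreeFermionic.weights, Matrix.GeneralLinearGroup.mkOfDetNeZero]
    field_simp
    linear_combination hN
  · have h₁ : u.a₁ * u.b₁ ≠ 0 := mul_ne_zero hu.1 hu.2.2.1
    have h₂ : u.a₂ * u.b₂ ≠ 0 := mul_ne_zero hu.2.1 hu.2.2.2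
    let d₁ : ℂˣ := Units.mk0 (u.N / (u.a₁ * u.b₁)) (div_ne_zero hN h₁)
    let d₂ : ℂˣ := Units.mk0 (u.N / (u.a₂ * u.b₂)) (div_ne_zero hN h₂)
    have e₁ : u.a₁ * u.b₁ * d₁ = u.N := mul_div_cancel₀ _ h₁
    have e₂ : u.a₂ * u.b₂ * d₂ = u.N := mul_div_cancel₀ _ h₂
    exact ⟨.inr ⟨u, d₁, d₂, NonFreeFermionic.mem_omegaBar u d₁ d₂ e₁ e₂, e₁, e₂⟩, rfl⟩

end SixVertex

/-! ### The parametrized Yang–Baxter equation -/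

namespace SixVertexGroupoid

/-- The six-vertex matrix `π(g)`, by its weights. -/
def weights : SixVertexGroupoid → SixVertex
  | .inl g => g.weights
  | .inr x => x.u

theorem toEnd_eq (g : SixVertexGroupoid) : g.toEnd = g.weights.toEnd := by
  cases g <;> rfl

theorem isScaledSolution_comp (g h : SixVertexGroupoid)
    (hd : (groupoid NonFreeFermionic.groupoid).Defined g h) :
    SixVertex.IsScaledSolution 1 g.weights
      ((groupoid NonFreeFermionic.groupoid).comp g h hd).weights h.weights := by
  rcases g with g | g <;> rcases h with h | h
  · exact FreeFermionic.isScaledSolution_mul g h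
  · exact hd.elim
  · exact hd.elim
  · exact NonFreeFermionic.isScaledSolution_comp hd

theorem ybCommutator_comp (g h : SixVertexGroupoid)
    (hd : (groupoid NonFreeFermionic.groupoid).Defined g h) :
    ybCommutator g.toEnd ((groupoid NonFreeFermionic.groupoid).comp g h hd).toEnd h.toEnd = 0 := by
  simp only [toEnd_eq]
  exact (SixVertex.ybCommutator_eq_zero_iff _ _ _).2 ⟨1, one_ne_zero, isScaledSolution_comp g h hd⟩

theorem isGroupoidYangBaxter :
    IsGroupoidYangBaxter (groupoid NonFreeFermionic.groupoid) toEnd obj where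
  yang_baxter := ybCommutator_comp
  defined_iff := by
    rintro (g | g) (h | h)
    · exact iff_of_true trivial rfl
    · exact iff_of_false id fun e => Units.ne_zero _ (Prod.ext_iff.1 e).1.symm
    · exact iff_of_false id fun e => Units.ne_zero _ (Prod.ext_iff.1 e).1
    · exact (NonFreeFermionic.composable_iff g h).trans
        ⟨fun e => Prod.ext e.1 e.2, fun e => ⟨congrArg Prod.fst e, congrArg Prod.snd e⟩⟩
  obj_comp := by
    rintro (g | g) (h | h) hd
    · rfl
    · exact hd.elim
    · exact hd.elim
    · rfl
  obj_inv_comp := by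
    rintro (g | g) (h | h) hd
    · rfl
    · exact hd.elim
    · exact hd.elim
    · -- Since `g'` is composable with `g ⋆ h`, its object is that of `(g ⋆ h)'`.
      have e := (NonFreeFermionic.composable_iff _ _).1 (g.inv_composable.comp_right hd)
      exact Prod.ext e.1.symm e.2.symm

/-- If `⟦π(g), w, π(h)⟧ = 0` has a six-vertex solution and `π(g)`, `π(h)` are in general position,
then `g ⋆ h` is defined: the relations `N_eq₁` and `N_eq₂` force both elements into the same part,
and in the non-free-fermionic part they say that `Δ(g) = Δ(h')`. -/
theorem defined_of_isScaledSolution {k : ℂ} (hk : k ≠ 0) {g h : SixVertexGroupoid} {w : SixVertex}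
    (hg : g.weights.IsGeneric) (hh : h.weights.IsGeneric)
    (hs : SixVertex.IsScaledSolution k g.weights w h.weights) :
    (groupoid NonFreeFermionic.groupoid).Defined g h := by
  have e₁ := hs.N_eq₁ hk
  have e₂ := hs.N_eq₂ hk
  obtain ⟨ga₁, ga₂, gb₁, gb₂⟩ := hg
  obtain ⟨ha₁, ha₂, hb₁, hb₂⟩ := hh
  rcases g with g | g <;> rcases h with h | h <;> simp only [weights] at *
  · trivial
  · rw [g.N_weights, mul_zero, ← h.eq₁] at e₁
    exact (mul_ne_zero (mul_ne_zero ga₁ gb₁) (mul_ne_zero (mul_ne_zero ha₁ hb₁) h.d₁.ne_zero)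
      e₁).elim
  · rw [h.N_weights, mul_zero, ← g.eq₁] at e₁
    exact (mul_ne_zero (mul_ne_zero ha₂ hb₁) (mul_ne_zero (mul_ne_zero ga₁ gb₁) g.d₁.ne_zero)
      e₁.symm).elim
  · have h₁ := h.eq₁
    have h₂ := h.eq₂
    rw [← g.eq₁] at e₁
    rw [← g.eq₂] at e₂
    have f₁ : h.u.N = h.u.a₂ * h.u.b₁ * g.d₁ :=
      mul_left_cancel₀ (mul_ne_zero ga₁ gb₁) (by linear_combination e₁)
    have f₂ : h.u.N = h.u.a₁ * h.u.b₂ * g.d₂ :=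
      mul_left_cancel₀ (mul_ne_zero ga₂ gb₂) (by linear_combination e₂)
    constructor
    · exact mul_left_cancel₀ hb₂ (by linear_combination -f₂ - h₂)
    · exact mul_left_cancel₀ hb₁ (by linear_combination -f₁ - h₁)
    · exact mul_left_cancel₀ ha₂ (by linear_combination -f₁ - h₂)
    · exact mul_left_cancel₀ ha₁ (by linear_combination -f₂ - h₁)

end SixVertexGroupoid

end

theorem mainTheorem1 :
    ∃ Γnf : PartialGroupoid NonFreeFermionic,
      (∀ x : NonFreeFermionic, x.IsInverse (Γnf.inv x)) ∧
      (∀ (x y : NonFreeFermionic) (h : Γnf.Defined x y), x.IsComposition y (Γnf.comp x y h)) ∧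
      IsGroupoidYangBaxter (SixVertexGroupoid.groupoid Γnf) SixVertexGroupoid.toEnd
        SixVertexGroupoid.obj ∧
      ∀ u v : SixVertex, u.IsGeneric → v.IsGeneric →
        ((∃ w : SixVertex, ybCommutator u.toEnd w.toEnd v.toEnd = 0) ↔
          ∃ g h : SixVertexGroupoid, g.toEnd = u.toEnd ∧ h.toEnd = v.toEnd ∧
            (SixVertexGroupoid.groupoid Γnf).Defined g h) ∧
        ∀ g h : SixVertexGroupoid, g.toEnd = u.toEnd → h.toEnd = v.toEnd →
          ((SixVertexGroupoid.groupoid Γnf).Defined g h ↔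
            ∃ w : SixVertex, ybCommutator u.toEnd w.toEnd v.toEnd = 0) ∧
          ∀ (hd : (SixVertexGroupoid.groupoid Γnf).Defined g h) (w : SixVertex),
            ybCommutator u.toEnd w.toEnd v.toEnd = 0 ↔
              ∃ k : ℂ, k ≠ 0 ∧
                w.toEnd = k • ((SixVertexGroupoid.groupoid Γnf).comp g h hd).toEnd := by
  refine ⟨NonFreeFermionic.groupoid, NonFreeFermionic.isInverse_inv,
    fun _ _ => NonFreeFermionic.isComposition_comp, SixVertexGroupoid.isGroupoidYangBaxter,
    fun u v hu hv => ?_⟩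
  have defined_iff (g h : SixVertexGroupoid) (hg : g.toEnd = u.toEnd) (hh : h.toEnd = v.toEnd) :
      (SixVertexGroupoid.groupoid NonFreeFermionic.groupoid).Defined g h ↔
        ∃ w : SixVertex, ybCommutator u.toEnd w.toEnd v.toEnd = 0 := by
    constructor
    · intro hd
      refine ⟨SixVertexGroupoid.weights (PartialGroupoid.comp _ g h hd), ?_⟩
      rw [← SixVertexGroupoid.toEnd_eq, ← hg, ← hh]
      exact SixVertexGroupoid.ybCommutator_comp g h hd
    · rintro ⟨w, hw⟩
      obtain ⟨k, hk, hs⟩ := (SixVertex.ybCommutator_eq_zero_iff _ _ _).1 hw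
      obtain rfl := SixVertex.toEnd_injective (g.toEnd_eq.symm.trans hg)
      obtain rfl := SixVertex.toEnd_injective (h.toEnd_eq.symm.trans hh)
      exact SixVertexGroupoid.defined_of_isScaledSolution hk hu hv hs
  refine ⟨⟨fun hw => ?_, ?_⟩, fun g h hg hh => ⟨defined_iff g h hg hh, fun hd w => ?_⟩⟩
  · obtain ⟨g, hg⟩ := hu.exists_toEnd_eq
    obtain ⟨h, hh⟩ := hv.exists_toEnd_eq
    exact ⟨g, h, hg, hh, (defined_iff g h hg hh).2 hw⟩
  · rintro ⟨g, h, hg, hh, hd⟩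
    exact (defined_iff g h hg hh).1 hd
  · constructor
    · intro hw
      obtain ⟨k, hk, hs⟩ := (SixVertex.ybCommutator_eq_zero_iff _ _ _).1 hw
      obtain rfl := SixVertex.toEnd_injective (g.toEnd_eq.symm.trans hg)
      obtain rfl := SixVertex.toEnd_injective (h.toEnd_eq.symm.trans hh)
      refine ⟨k, hk, ?_⟩
      rw [SixVertexGroupoid.toEnd_eq]
      exact hs.toEnd_eq hu (SixVertexGroupoid.isScaledSolution_comp g h hd)
    · rintro ⟨k, -, hw⟩
      rw [hw, ybCommutator_smul, ← hg, ← hh, SixVertexGroupoid.ybCommutator_comp, smul_zero]
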